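/- Let $n\ge 3$ and $\beta>0$, let $N=\{1,\dots,n\}$ be the set of agents and $V=[0,\beta]$ the set of possible valuations of each agent. An allocation rule is a map $f:V^n\to[0,1]^n$ with $\sum_{i\in N} f_i(\mathbf v)\le 1$ for all $\mathbf v\in V^n$. It is satisfactorily implementable if there are payment rules $p_i:V^n\to\mathbb R$ ($i\in N$) such that the mechanism $(f,\mathbf p)$ is - dominant strategy incentive compatible: $v_if_i(v_i,v_{-i})-p_i(v_i,v_{-i})\ge v_if_i(v_i',v_{-i})-p_i(v_i',v_{-i})$ for all $i\in N$, all $v_i,v_i'\in V$ and all valuations $v_{-i}$ of the other agents; - budget-balanced: $\sum_{i\in N}p_i(\mathbf v)=0$ for all $\mathbf v\in V^n$; - symmetric: for all $\mathbf v\in V^n$ and $i,j\in N$, if $v_i=v_j$ then $f_i(\mathbf v)=f_j(\mathbf v)$ and $p_i(\mathbf v)=p_j(\mathbf v)$. For a profile $\mathbf v$ let $\mathbf v[1]$ be the set of agents with the highest valuation and, recursively, let $\mathbf v[k]$ be the set of agents with the highest valuation among those not in $\mathbf v[1]\cup\dots\cup\mathbf v[k-1]$; put $L_k(\mathbf v)=|\mathbf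 v[1]\cup\dots\cup\mathbf v[k]|$. A ranking allocation rule with probabilities $(\pi_1,\dots,\pi_n)$, where $1\ge\pi_1\ge\dots\ge\pi_n\ge 0$ and $\sum_{i}\pi_i\le 1$, is an allocation rule $f$ such that $f_i(\mathbf v)=f_j(\mathbf v)$ whenever $v_i=v_j$, and $$\sum_{i\in \mathbf v[1]\cup\dots\cup\mathbf v[k]}f_i(\mathbf v)=\sum_{j=1}^{L_k(\mathbf v)}\pi_j\qquad\text{for all }\mathbf v\in V^n,\ k\in N.$$ It is a two-step rule if for some $\ell$ its probabilities are $(\pi_1,\pi_2,\dots,\pi_2,0,\dots,0)$, with $\pi_2$ occurring $\ell-1$ times, where $\pi_1>\pi_2>0$ and $\pi_1+(\ell-1)\pi_2=1$. A ranking allocation rule with probabilities $(\pi_1,\dots,\pi_n)$ is r-optimal if it is satisfactorily implementable and $\pi_1\ge\pi_1'$ for every satisfactorily implementable ranking allocation rule with probabilities $(\pi_1',\dots,\pi_n')$. **Theorem.** There is a two-step ranking allocation rule that is r-optimal. More precisely, the set $$\operatorname*{arg\,min}_{2\le i\le n-1,\ i\text{ even}}\ \frac{i-1}{\binom{n-2}{i-1}+i}$$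 is nonempty, and for every $\ell$ in it the numbers $$\pi_i^*=\begin{cases}1-\dfrac{\ell-1}{\binom{n-2}{\ell-1}+\ell}&\text{if }i=1,\\[2ex]\dfrac{1}{\binom{n-2}{\ell-1}+\ell}&\text{if }i\in\{2,\dots,\ell\},\\[2ex]0&\text{otherwise}\end{cases}$$ are the probabilities of a two-step ranking allocation rule that is r-optimal. Moreover, if $n\ne 8$, this is the only r-optimal ranking allocation rule, and $(\pi_1^*,\dots,\pi_n^*)$ are its only probabilities. -/

import Mathlib

namespace RankingMechanism

/-- The set `V = [0, β]` of possible valuations of an agent. -/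
abbrev Valuation (β : ℝ) : Type := Set.Icc (0 : ℝ) β

/-- Valuation profiles of the `n` agents; the agents are the elements of `Fin n`. -/
abbrev Profile (n : ℕ) (β : ℝ) : Type := Fin n → Valuation β

/-- An allocation rule `f : V ^ n → [0, 1] ^ n` with total probability at most `1` at every
profile; `f.prob v i` is the probability that agent `i` gets the object at the profile `v`. -/
@[ext]
structure AllocationRule (n : ℕ) (β : ℝ) where
  prob : Profile n β → Fin n → ℝ
  prob_mem : ∀ v i, prob v i ∈ Set.Icc (0 : ℝ) 1
  sum_le_one : ∀ v, ∑ i, prob v i ≤ 1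

/-- Payment rules of all agents; `p v i` is what agent `i` pays at the profile `v`. -/
abbrev PaymentRule (n : ℕ) (β : ℝ) : Type := Profile n β → Fin n → ℝ

variable {n : ℕ} {β : ℝ}

/-- Dominant strategy incentive compatibility: at a profile `v` of true valuations, agent `i`
does not gain by reporting `x` in place of `v i`, whatever the reports of the others. -/
def IsDSIC (f : AllocationRule n β) (p : PaymentRule n β) : Prop :=
  ∀ (i : Fin n) (v : Profile n β) (x : Valuation β),
    (v i : ℝ) * f.prob (Function.update v i x) i - p (Function.update v i x) i
      ≤ (v i : ℝ) * f.prob v i - p v i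

/-- Budget balance. -/
def IsBudgetBalanced (p : PaymentRule n β) : Prop :=
  ∀ v : Profile n β, ∑ i, p v i = 0

/-- Symmetry of a family of quantities indexed by profiles and agents: agents with equal
valuations are treated equally. -/
def IsSymmetric (q : Profile n β → Fin n → ℝ) : Prop :=
  ∀ (v : Profile n β) (i j : Fin n), v i = v j → q v i = q v j

/-- Satisfactory mechanisms: DSIC, budget-balanced and symmetric. -/
structure IsSatisfactory (f : AllocationRule n β) (p : PaymentRule n β) : Prop where
  dsic : IsDSIC f p
  budgetBalanced : IsBudgetBalanced p
  symmetric_alloc : IsSymmetric f.prob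
  symmetric_payment : IsSymmetric p

/-- `f` is satisfactorily implementable. -/
def IsSatisfactorilyImplementable (f : AllocationRule n β) : Prop :=
  ∃ p : PaymentRule n β, IsSatisfactory f p

/-- The agents in `S` whose valuation is highest among the agents in `S`. -/
noncomputable def highest (v : Profile n β) (S : Finset (Fin n)) : Finset (Fin n) :=
  S.filter fun i => ∀ j ∈ S, v j ≤ v i

/-- `upToRank v k` is the union `v[1] ∪ ⋯ ∪ v[k]`, where `v[j]` is the set of agents with the
`j`-th highest valuation at `v`; thus `v[k + 1]` is `highest v (upToRank v k)ᶜ`. -/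
noncomputable def upToRank (v : Profile n β) : ℕ → Finset (Fin n)
  | 0 => ∅
  | k + 1 => upToRank v k ∪ highest v (upToRank v k)ᶜ

/-- `f` is the ranking allocation rule with probabilities `π`. The entry `π i` belongs to rank
`i + 1`, so that the agents of `v[1] ∪ ⋯ ∪ v[k]`, say `L` of them, share the
probabilities of the ranks `1, …, L`. -/
structure IsRanking (f : AllocationRule n β) (π : Fin n → ℝ) : Prop where
  symmetric : IsSymmetric f.prob
  mem_Icc : ∀ i, π i ∈ Set.Icc (0 : ℝ) 1
  antitone : Antitone π
  sum_le_one : ∑ i, π i ≤ 1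
  sum_upToRank : ∀ (v : Profile n β) (k : ℕ), 1 ≤ k → k ≤ n →
    ∑ i ∈ upToRank v k, f.prob v i
      = ∑ j ∈ Finset.univ.filter (fun j : Fin n => j.val < (upToRank v k).card), π j

/-- `f` is the ranking allocation rule with probabilities `π`, and it is two-step: its
probabilities are `(p₁, p₂, …, p₂, 0, …, 0)`, with `ℓ - 1` entries `p₂`, where `p₁ > p₂ > 0` and
`p₁ + (ℓ - 1) p₂ = 1`. -/
def IsTwoStepRanking (f : AllocationRule n β) (π : Fin n → ℝ) (ℓ : ℕ) : Prop :=
  IsRanking f π ∧ 1 ≤ ℓ ∧ ℓ ≤ n ∧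
    ∃ p₁ p₂ : ℝ, p₂ < p₁ ∧ 0 < p₂ ∧ p₁ + ((ℓ : ℝ) - 1) * p₂ = 1 ∧
      ∀ i : Fin n, π i = if i.val = 0 then p₁ else if i.val < ℓ then p₂ else 0

/-- The ranking allocation rule `f` with probabilities `π` is r-optimal: it is satisfactorily
implementable, and its probability for the top rank is at least that of every satisfactorily
implementable ranking allocation rule. -/
def IsROptimal (f : AllocationRule n β) (π : Fin n → ℝ) : Prop :=
  IsRanking f π ∧ IsSatisfactorilyImplementable f ∧
    ∀ (g : AllocationRule n β) (ρ : Fin n → ℝ), IsRanking g ρ →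
      IsSatisfactorilyImplementable g → ∀ i : Fin n, i.val = 0 → ρ i ≤ π i

/-- The even integers `i` with `2 ≤ i ≤ n - 1`. -/
def candidates (n : ℕ) : Set ℕ := {i | 2 ≤ i ∧ i ≤ n - 1 ∧ Even i}

/-- The objective `(i - 1) / (C(n - 2, i - 1) + i)`. -/
noncomputable def objective (n i : ℕ) : ℝ :=
  ((i : ℝ) - 1) / (((n - 2).choose (i - 1) : ℝ) + (i : ℝ))

/-- The minimizers of the objective over the even `i` with `2 ≤ i ≤ n - 1`. -/
def argminSet (n : ℕ) : Set ℕ :=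
  {ℓ | ℓ ∈ candidates n ∧ ∀ i ∈ candidates n, objective n ℓ ≤ objective n i}

/-- The probabilities `(π₁*, …, πₙ*)` determined by `ℓ`; index `i` stands for rank `i + 1`. -/
noncomputable def optimalProb (n ℓ : ℕ) (i : Fin n) : ℝ :=
  if i.val = 0 then 1 - ((ℓ : ℝ) - 1) / (((n - 2).choose (ℓ - 1) : ℝ) + (ℓ : ℝ))
  else if i.val < ℓ then 1 / (((n - 2).choose (ℓ - 1) : ℝ) + (ℓ : ℝ))
  else 0

end RankingMechanism

/-!
The theorem is a linear program in the probabilities `π`, once implementability has been turned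
into one linear equation. A ranking allocation rule is satisfactorily implementable exactly when
`∑ k < n, (-1) ^ k * C(n - 1, k) * π_{k + 1} = 0` (`alternatingSum π = 0`).

*Necessity* (`alternatingSum_eq_zero_of_implementable`). At the profiles with valuations in
`{0, β}`, incentive compatibility fixes the utility difference of an agent between reporting `β`
and `0`, since its probability is constant at interior reports. What remains of its utility does
not depend on its own valuation, and hence cancels from the sum over all such profiles with
alternating signs; budget balance turns this into the equation.

*Sufficiency* (`isSatisfactory_rankingPayment`). Payments are written as integrals over levels `x`,
so that only the number of agents with valuations above `x` matters and no sorting is needed. The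
payment is the value of the object less the information rent and less a compensation that depends
on the other agents only; balancing the budget at each level is a triangular linear system for
the compensations (`compensation_balance`), whose last equation is solvable by the alternating sum
condition. Incentive compatibility also holds level by level.

*Optimization*. In the variables `π_k - π_{k + 1} ≥ 0` the program has two constraints, the
alternating sum and the total probability. With `δ` the minimum of the objective, the dual point
`(1 - δ, δ)` is feasible and has value `1 - δ` (`sum_dualSlack_mul`, `dualSlack_nonneg_and`), which
`optimalProb` attains. The dual constraints are tight only for the first rank alone and at the
minimizers of the objective, so that a unique minimizer gives a unique optimal `π`
(`eq_optimalProb_of_rankProb_zero_eq`), which in turn determines the rule.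

*Uniqueness of the minimizer* (`argminSet_subsingleton`). Put `m = n - 2`. Minimizing the objective
at `i = j + 1` amounts to maximizing `(C(m, j) + 1) / j` over odd `j`. The sequence `C(m, j) / j`,
taken in steps of two, never increases again once it has not increased, and the extra `1` can
interfere with the comparison of neighbours only for `m = 6`, where `j = 1` and `j = 3` tie.
-/

namespace RankingMechanism

variable {n : ℕ} {β : ℝ}

/-! ### Probabilities of ranks and their partial sums -/

/-- The probability of the rank with exactly `k` ranks ahead of it, extended by `0` to `n ≤ k`. -/
noncomputable def rankProb (π : Fin n → ℝ) (k : ℕ) : ℝ := if h : k < n then π ⟨k, h⟩ else 0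

/-- The total probability of the first `k` ranks. -/
noncomputable def cumProb (π : Fin n → ℝ) (k : ℕ) : ℝ := ∑ j ∈ Finset.range k, rankProb π j

lemma rankProb_val (π : Fin n → ℝ) (j : Fin n) : rankProb π j = π j := by
  simp [rankProb]

lemma rankProb_of_le (π : Fin n → ℝ) {k : ℕ} (hk : n ≤ k) : rankProb π k = 0 := by
  simp [rankProb, hk]

lemma cumProb_succ (π : Fin n → ℝ) (k : ℕ) :
    cumProb π (k + 1) = cumProb π k + rankProb π k := by
  simp [cumProb, Finset.sum_range_succ]

lemma sum_filter_lt_eq_cumProb (π : Fin n → ℝ) (k : ℕ) :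
    ∑ j ∈ Finset.univ.filter (fun j : Fin n => j.val < k), π j = cumProb π k := by
  have h1 : ∑ j ∈ Finset.univ.filter (fun j : Fin n => j.val < k), π j
      = ∑ j : Fin n, (fun t : ℕ => if t < k then rankProb π t else 0) j := by
    rw [Finset.sum_filter]
    exact Finset.sum_congr rfl fun j _ => by simp [rankProb_val]
  rw [h1, Fin.sum_univ_eq_sum_range (fun t : ℕ => if t < k then rankProb π t else 0) n,
    ← Finset.sum_filter, cumProb]
  refine Finset.sum_subset (fun t ht => ?_) (fun t ht ht' => ?_)
  · simp only [Finset.mem_filter, Finset.mem_range] at ht ⊢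
    exact ht.2
  · simp only [Finset.mem_filter, Finset.mem_range] at ht ht'
    exact rankProb_of_le π (by omega)

lemma sum_eq_cumProb (π : Fin n → ℝ) : ∑ i, π i = cumProb π n := by
  rw [← sum_filter_lt_eq_cumProb, Finset.filter_true_of_mem fun i _ => i.2]

lemma rankProb_nonneg {π : Fin n → ℝ} (h : ∀ i, π i ∈ Set.Icc (0 : ℝ) 1) (k : ℕ) :
    0 ≤ rankProb π k := by
  unfold rankProb
  split_ifs with hk
  · exact (h _).1
  · exact le_rfl

lemma rankProb_le_one {π : Fin n → ℝ} (h : ∀ i, π i ∈ Set.Icc (0 : ℝ) 1) (k : ℕ) :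
    rankProb π k ≤ 1 := by
  unfold rankProb
  split_ifs with hk
  · exact (h _).2
  · exact zero_le_one

lemma rankProb_antitone {π : Fin n → ℝ} (h : ∀ i, π i ∈ Set.Icc (0 : ℝ) 1) (ha : Antitone π) :
    Antitone (rankProb π) := by
  intro k l hkl
  by_cases hl : l < n
  · have hk : k < n := by omega
    simpa [rankProb, hl, hk] using ha (show (⟨k, hk⟩ : Fin n) ≤ ⟨l, hl⟩ from hkl)
  · rw [rankProb_of_le π (not_lt.mp hl)]
    exact rankProb_nonneg h k

/-- The average of `m` consecutive terms of an antitone sequence lies between the last and the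
first of them. -/
lemma cumProb_add_sub_bounds {π : Fin n → ℝ} (ha : Antitone (rankProb π)) (a m : ℕ) :
    (m : ℝ) * rankProb π (a + m - 1) ≤ cumProb π (a + m) - cumProb π a ∧
      cumProb π (a + m) - cumProb π a ≤ m * rankProb π a := by
  have h : cumProb π (a + m) - cumProb π a = ∑ j ∈ Finset.range m, rankProb π (a + j) := by
    rw [cumProb, cumProb, Finset.sum_range_add]; ring
  rw [h]
  constructor
  · have := Finset.card_nsmul_le_sum (Finset.range m) (fun j => rankProb π (a + j))
      (rankProb π (a + m - 1)) (fun j hj => ha (by have := Finset.mem_range.mp hj; omega))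
    simpa using this
  · have := Finset.sum_le_card_nsmul (Finset.range m) (fun j => rankProb π (a + j))
      (rankProb π a) (fun j hj => ha (by omega))
    simpa using this

/-! ### Upper sets of agents -/

/-- A set of agents that contains, with each agent, all agents of at least the same valuation. -/
def IsUpperAgents (v : Profile n β) (S : Finset (Fin n)) : Prop :=
  ∀ i ∈ S, ∀ j, v i ≤ v j → j ∈ S

lemma mem_highest {v : Profile n β} {S : Finset (Fin n)} {i : Fin n} :
    i ∈ highest v S ↔ i ∈ S ∧ ∀ j ∈ S, v j ≤ v i := by
  simp [highest]

lemma highest_nonempty (v : Profile n β) {S : Finset (Fin n)} (hS : S.Nonempty) :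
    (highest v S).Nonempty := by
  obtain ⟨i, hi, h⟩ := Finset.exists_max_image S v hS
  exact ⟨i, mem_highest.mpr ⟨hi, h⟩⟩

lemma isUpperAgents_upToRank (v : Profile n β) (k : ℕ) : IsUpperAgents v (upToRank v k) := by
  induction k with
  | zero => intro i hi; simp [upToRank] at hi
  | succ k ih =>
    intro i hi j hij
    simp only [upToRank, Finset.mem_union, mem_highest, Finset.mem_compl] at hi ⊢
    by_cases hj : j ∈ upToRank v k
    · exact Or.inl hj
    · refine Or.inr ⟨hj, fun l hl => ?_⟩
      rcases hi with hi | hi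
      · exact absurd (ih i hi j hij) hj
      · exact (hi.2 l hl).trans hij

lemma exists_upToRank_eq {v : Profile n β} {S : Finset (Fin n)} (hS : IsUpperAgents v S) :
    ∃ k ≤ n, upToRank v k = S := by
  -- as long as `S` has not been reached, each step adds agents of `S` only, and at least one
  have key : ∀ k, (∃ m ≤ k, upToRank v m = S) ∨
      (upToRank v k ⊆ S ∧ k ≤ (upToRank v k).card) := by
    intro k
    induction k with
    | zero => right; simp [upToRank]
    | succ k ih =>
      rcases ih with ⟨m, hm, h⟩ | ⟨hsub, hcard⟩
      · exact Or.inl ⟨m, by omega, h⟩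
      · by_cases heq : upToRank v k = S
        · exact Or.inl ⟨k, by omega, heq⟩
        · right
          obtain ⟨s, hs, hsk⟩ := Finset.exists_of_ssubset (hsub.ssubset_of_ne heq)
          refine ⟨fun i hi => ?_, ?_⟩
          · simp only [upToRank, Finset.mem_union, mem_highest, Finset.mem_compl] at hi
            rcases hi with hi | hi
            · exact hsub hi
            · exact hS s hs i (hi.2 s hsk)
          · have hne : (highest v (upToRank v k)ᶜ).Nonempty :=
              highest_nonempty v ⟨s, Finset.mem_compl.mpr hsk⟩
            have hd : Disjoint (upToRank v k) (highest v (upToRank v k)ᶜ) := by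
              rw [Finset.disjoint_left]
              intro i hi hi'
              exact Finset.mem_compl.mp (mem_highest.mp hi').1 hi
            rw [upToRank, Finset.card_union_of_disjoint hd]
            have := hne.card_pos
            omega
  rcases key n with h | ⟨hsub, hcard⟩
  · exact h
  · refine ⟨n, le_rfl, ?_⟩
    have hu : upToRank v n = Finset.univ :=
      Finset.eq_univ_of_card _ (le_antisymm (Finset.card_le_univ _) (by simpa using hcard))
    rw [hu] at hsub ⊢
    exact (Finset.univ_subset_iff.mp hsub).symm

/-- In a ranking allocation rule, an upper set of agents gets the total probability of the ranks
that it occupies. -/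
lemma IsRanking.sum_upper {f : AllocationRule n β} {π : Fin n → ℝ} (h : IsRanking f π)
    {v : Profile n β} {S : Finset (Fin n)} (hS : IsUpperAgents v S) :
    ∑ i ∈ S, f.prob v i = cumProb π S.card := by
  obtain ⟨k, hk, rfl⟩ := exists_upToRank_eq hS
  rcases Nat.eq_zero_or_pos k with rfl | hpos
  · simp [upToRank, cumProb]
  · rw [h.sum_upToRank v k hpos hk, sum_filter_lt_eq_cumProb]

/-- The agents strictly ahead of agent `i`. -/
noncomputable def ahead (v : Profile n β) (i : Fin n) : Finset (Fin n) :=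
  Finset.univ.filter fun j => v i < v j

/-- The agents tied with agent `i`, including `i`. -/
noncomputable def tied (v : Profile n β) (i : Fin n) : Finset (Fin n) :=
  Finset.univ.filter fun j => v j = v i

lemma mem_tied {v : Profile n β} {i j : Fin n} : j ∈ tied v i ↔ v j = v i := by simp [tied]

lemma tied_card_pos (v : Profile n β) (i : Fin n) : 0 < (tied v i).card :=
  Finset.card_pos.mpr ⟨i, by simp [tied]⟩

lemma disjoint_ahead_tied (v : Profile n β) (i : Fin n) : Disjoint (ahead v i) (tied v i) := by
  rw [Finset.disjoint_left]
  intro j hj hj'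
  simp only [ahead, tied, Finset.mem_filter, Finset.mem_univ, true_and] at hj hj'
  exact hj.ne hj'.symm

lemma IsRanking.card_tied_mul {f : AllocationRule n β} {π : Fin n → ℝ} (h : IsRanking f π)
    (v : Profile n β) (i : Fin n) :
    ((tied v i).card : ℝ) * f.prob v i
      = cumProb π ((ahead v i).card + (tied v i).card) - cumProb π (ahead v i).card := by
  have h1 : IsUpperAgents v (ahead v i) := by
    intro a ha b hab
    simp only [ahead, Finset.mem_filter, Finset.mem_univ, true_and] at ha ⊢
    exact ha.trans_le hab
  have h2 : IsUpperAgents v (ahead v i ∪ tied v i) := by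
    intro a ha b hab
    simp only [ahead, tied, Finset.mem_union, Finset.mem_filter, Finset.mem_univ,
      true_and] at ha ⊢
    have : v i ≤ v b := by
      rcases ha with ha | ha
      · exact ha.le.trans hab
      · exact ha ▸ hab
    exact (this.lt_or_eq).imp id Eq.symm
  have e1 := h.sum_upper h1
  have e2 := h.sum_upper h2
  have hd := disjoint_ahead_tied v i
  rw [Finset.sum_union hd, Finset.card_union_of_disjoint hd, e1] at e2
  have e3 : ∑ j ∈ tied v i, f.prob v j = (tied v i).card * f.prob v i := by
    rw [Finset.sum_congr rfl fun j hj => h.symmetric v j i (mem_tied.mp hj)]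
    simp
  linarith

lemma IsRanking.eq_of_same_prob {f g : AllocationRule n β} {π : Fin n → ℝ}
    (hf : IsRanking f π) (hg : IsRanking g π) : f = g := by
  ext v i
  have h1 := hf.card_tied_mul v i
  rw [← hg.card_tied_mul v i] at h1
  have : ((tied v i).card : ℝ) ≠ 0 := by
    exact_mod_cast (tied_card_pos v i).ne'
  exact mul_left_cancel₀ this h1

/-- The number of agents other than `i` whose valuation exceeds `x`. -/
noncomputable def numOthersAbove (v : Profile n β) (i : Fin n) (x : ℝ) : ℕ :=
  ((Finset.univ.erase i).filter fun j => x < (v j : ℝ)).card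

lemma numOthersAbove_update (v : Profile n β) (i : Fin n) (y : Valuation β) (x : ℝ) :
    numOthersAbove (Function.update v i y) i x = numOthersAbove v i x := by
  unfold numOthersAbove
  congr 1
  refine Finset.filter_congr fun j hj => ?_
  rw [Function.update_of_ne (Finset.ne_of_mem_erase hj)]

/-- The probability of agent `i` is at least the one that would be due for a report `x` below the
valuation of `i`. -/
lemma rankProb_numOthersAbove_le {π : Fin n → ℝ} (ha : Antitone (rankProb π))
    {v : Profile n β} {i : Fin n} {q : ℝ}
    (hq : ((tied v i).card : ℝ) * q
      = cumProb π ((ahead v i).card + (tied v i).card) - cumProb π (ahead v i).card)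
    {x : ℝ} (hx : x < v i) : rankProb π (numOthersAbove v i x) ≤ q := by
  have hm : (0 : ℝ) < (tied v i).card := by exact_mod_cast tied_card_pos v i
  have h1 := (cumProb_add_sub_bounds ha (ahead v i).card (tied v i).card).1
  rw [← hq] at h1
  refine le_trans (ha ?_) (le_of_mul_le_mul_left h1 hm)
  have hsub : (ahead v i ∪ tied v i).erase i
      ⊆ (Finset.univ.erase i).filter fun j => x < (v j : ℝ) := by
    intro j hj
    simp only [ahead, tied, Finset.mem_erase, Finset.mem_union, Finset.mem_filter,
      Finset.mem_univ, true_and, and_true] at hj ⊢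
    refine ⟨hj.1, ?_⟩
    rcases hj.2 with h | h
    · exact hx.trans h
    · rwa [h]
  have := Finset.card_le_card hsub
  rwa [Finset.card_erase_of_mem (by simp [tied]),
    Finset.card_union_of_disjoint (disjoint_ahead_tied v i)] at this

/-- The probability of agent `i` is at most the one that would be due for a report `x` not below
the valuation of `i`. -/
lemma le_rankProb_numOthersAbove {π : Fin n → ℝ} (ha : Antitone (rankProb π))
    {v : Profile n β} {i : Fin n} {q : ℝ}
    (hq : ((tied v i).card : ℝ) * q
      = cumProb π ((ahead v i).card + (tied v i).card) - cumProb π (ahead v i).card)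
    {x : ℝ} (hx : v i ≤ x) : q ≤ rankProb π (numOthersAbove v i x) := by
  have hm : (0 : ℝ) < (tied v i).card := by exact_mod_cast tied_card_pos v i
  have h1 := (cumProb_add_sub_bounds ha (ahead v i).card (tied v i).card).2
  rw [← hq] at h1
  refine le_trans (le_of_mul_le_mul_left h1 hm) (ha ?_)
  refine Finset.card_le_card fun j hj => ?_
  simp only [ahead, Finset.mem_filter, Finset.mem_univ, true_and] at hj ⊢
  exact Subtype.coe_lt_coe.mp (hx.trans_lt hj.2)

/-! ### The ranking allocation rule with given probabilities -/

/-- The probability of agent `i` in the ranking allocation rule: tied agents share equally the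
probabilities of the ranks that they occupy. -/
noncomputable def sharedProb (π : Fin n → ℝ) (v : Profile n β) (i : Fin n) : ℝ :=
  (cumProb π ((ahead v i).card + (tied v i).card) - cumProb π (ahead v i).card)
    / (tied v i).card

lemma card_tied_mul_sharedProb (π : Fin n → ℝ) (v : Profile n β) (i : Fin n) :
    ((tied v i).card : ℝ) * sharedProb π v i
      = cumProb π ((ahead v i).card + (tied v i).card) - cumProb π (ahead v i).card := by
  have : ((tied v i).card : ℝ) ≠ 0 := by exact_mod_cast (tied_card_pos v i).ne'
  rw [sharedProb, mul_div_cancel₀ _ this]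

lemma isSymmetric_sharedProb (π : Fin n → ℝ) :
    IsSymmetric (sharedProb π : Profile n β → Fin n → ℝ) := by
  intro v i j h
  simp only [sharedProb, ahead, tied, h]

lemma sum_upToRank_sharedProb (π : Fin n → ℝ) (v : Profile n β) (k : ℕ) :
    ∑ i ∈ upToRank v k, sharedProb π v i = cumProb π (upToRank v k).card := by
  induction k with
  | zero => simp [upToRank, cumProb]
  | succ k ih =>
    rcases Finset.eq_empty_or_nonempty (highest v (upToRank v k)ᶜ) with h0 | ⟨i, hi⟩
    · simp only [upToRank, h0, Finset.union_empty, ih]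
    · have hi' := mem_highest.mp hi
      have hit : highest v (upToRank v k)ᶜ = tied v i := by
        ext j
        simp only [mem_highest, tied, Finset.mem_filter, Finset.mem_univ, true_and]
        constructor
        · exact fun hj => le_antisymm (hi'.2 j hj.1) (hj.2 i hi'.1)
        · intro hj
          refine ⟨Finset.mem_compl.mpr fun hjk => ?_, fun l hl => hj ▸ hi'.2 l hl⟩
          exact Finset.mem_compl.mp hi'.1 (isUpperAgents_upToRank v k j hjk i hj.le)
      have hia : upToRank v k = ahead v i := by
        ext j
        simp only [ahead, Finset.mem_filter, Finset.mem_univ, true_and]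
        constructor
        · intro hj
          by_contra hlt
          exact Finset.mem_compl.mp hi'.1 (isUpperAgents_upToRank v k j hj i (not_lt.mp hlt))
        · intro hj
          by_contra hjk
          exact absurd (hi'.2 j (Finset.mem_compl.mpr hjk)) (not_le.mpr hj)
      have hd := disjoint_ahead_tied v i
      rw [hia] at ih
      rw [upToRank, hit, hia]
      rw [Finset.sum_union hd, Finset.card_union_of_disjoint hd, ih,
        Finset.sum_congr rfl fun j hj =>
          isSymmetric_sharedProb π v j i (mem_tied.mp hj),
        Finset.sum_const, nsmul_eq_mul, card_tied_mul_sharedProb]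
      ring

lemma exists_isRanking {π : Fin n → ℝ} (h : ∀ i, π i ∈ Set.Icc (0 : ℝ) 1) (ha : Antitone π)
    (hs : ∑ i, π i ≤ 1) : ∃ f : AllocationRule n β, IsRanking f π := by
  have hanti := rankProb_antitone h ha
  refine ⟨⟨sharedProb π, fun v i => ⟨?_, ?_⟩, fun v => ?_⟩,
    ⟨isSymmetric_sharedProb π, h, ha, hs, fun v k _ _ => ?_⟩⟩
  · exact (rankProb_nonneg h _).trans
      (rankProb_numOthersAbove_le hanti (card_tied_mul_sharedProb π v i) (sub_one_lt _))
  · exact (le_rankProb_numOthersAbove hanti (card_tied_mul_sharedProb π v i) le_rfl).trans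
      (rankProb_le_one h _)
  · obtain ⟨k, -, hk⟩ := exists_upToRank_eq (v := v) (S := Finset.univ)
      fun _ _ _ _ => Finset.mem_univ _
    have := sum_upToRank_sharedProb π v k
    rw [hk, Finset.card_univ, Fintype.card_fin, ← sum_eq_cumProb] at this
    exact this.trans_le hs
  · exact (sum_upToRank_sharedProb π v k).trans (sum_filter_lt_eq_cumProb π _).symm

/-! ### Alternating binomial sums -/

/-- The alternating binomial sum whose vanishing characterizes the satisfactorily implementable
ranking allocation rules. -/
noncomputable def alternatingSum (π : Fin n → ℝ) : ℝ :=
  ∑ k ∈ Finset.range n, (-1 : ℝ) ^ k * ((n - 1).choose k : ℝ) * rankProb π k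

/-- When valuations are `0` or `x` and `k` agents have valuation `x`, the surplus minus the sum of
the information rents is `x * residual π k`. -/
noncomputable def residual (π : Fin n → ℝ) (k : ℕ) : ℝ :=
  cumProb π k - k * rankProb π (k - 1)

lemma sum_range_alternating_choose (N m : ℕ) :
    ∑ k ∈ Finset.range (m + 1), (-1 : ℝ) ^ k * ((N + 1).choose k : ℝ)
      = (-1) ^ m * (N.choose m : ℝ) := by
  induction m with
  | zero => simp
  | succ m ih =>
    rw [Finset.sum_range_succ, ih, Nat.choose_succ_succ]
    push_cast
    ring

lemma sum_alternating_choose_mul_cumProb (π : Fin n → ℝ) (N m : ℕ) :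
    ∑ k ∈ Finset.range (m + 1), (-1 : ℝ) ^ k * ((N + 1).choose k : ℝ) * cumProb π k
      = (-1) ^ m * (N.choose m : ℝ) * cumProb π m
        - ∑ j ∈ Finset.range m, (-1 : ℝ) ^ j * (N.choose j : ℝ) * rankProb π j := by
  induction m with
  | zero => simp [cumProb]
  | succ m ih =>
    rw [Finset.sum_range_succ, ih, Finset.sum_range_succ _ m, Nat.choose_succ_succ, cumProb_succ]
    push_cast
    ring

lemma sum_alternating_choose_mul_residual (hn : 1 ≤ n) (π : Fin n → ℝ) :
    ∑ k ∈ Finset.range (n + 1), (-1 : ℝ) ^ k * (n.choose k : ℝ) * residual π k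
      = ((n : ℝ) - 1) * alternatingSum π := by
  obtain ⟨N, rfl⟩ : ∃ N, n = N + 1 := ⟨n - 1, by omega⟩
  have h1 := sum_alternating_choose_mul_cumProb π N (N + 1)
  have h2 : ∑ k ∈ Finset.range (N + 1 + 1),
      (-1 : ℝ) ^ k * ((N + 1).choose k : ℝ) * (k * rankProb π (k - 1))
      = -((N : ℝ) + 1) * alternatingSum π := by
    rw [Finset.sum_range_succ', alternatingSum, Finset.mul_sum]
    simp only [Nat.cast_zero, zero_mul, mul_zero, add_zero]
    refine Finset.sum_congr rfl fun k _ => ?_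
    have h : ((N : ℝ) + 1) * (N.choose k : ℝ) = ((N + 1).choose (k + 1) : ℝ) * (k + 1) := by
      exact_mod_cast Nat.add_one_mul_choose_eq N k
    simp only [Nat.add_sub_cancel]
    push_cast
    linear_combination (-1 : ℝ) ^ k * rankProb π k * h
  simp only [residual, mul_sub, Finset.sum_sub_distrib]
  rw [h1, h2, Nat.choose_succ_self, alternatingSum]
  push_cast
  ring

lemma sum_mul_eq_sum_partial_mul_sub (a e : ℕ → ℝ) (n : ℕ) :
    ∑ k ∈ Finset.range n, a k * e k
      = ∑ k ∈ Finset.range n, (∑ j ∈ Finset.range (k + 1), a j) * (e k - e (k + 1))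
        + (∑ j ∈ Finset.range n, a j) * e n := by
  induction n with
  | zero => simp
  | succ n ih =>
    rw [Finset.sum_range_succ, ih, Finset.sum_range_succ _ n, Finset.sum_range_succ a n]
    ring

/-! ### The linear program -/

/-- The slack, at `k`, of the dual constraint belonging to the rule that gives equal probability
to the first `k + 1` ranks; `δ` is the dual variable. -/
noncomputable def dualSlack (n : ℕ) (δ : ℝ) (k : ℕ) : ℝ :=
  (1 - δ) * (k + 1) + δ * ((-1) ^ k * ((n - 2).choose k : ℝ)) - 1

/-- Weak duality as an identity: the gap between dual and primal value is the sum of the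
slacks. -/
lemma sum_dualSlack_mul (hn : 2 ≤ n) (π : Fin n → ℝ) (δ : ℝ) :
    ∑ k ∈ Finset.range n, dualSlack n δ k * (rankProb π k - rankProb π (k + 1))
      = (1 - δ) * cumProb π n + δ * alternatingSum π - rankProb π 0 := by
  obtain ⟨m, rfl⟩ : ∃ m, n = m + 2 := ⟨n - 2, by omega⟩
  have hend : rankProb π (m + 2) = 0 := rankProb_of_le π le_rfl
  have h1 := sum_mul_eq_sum_partial_mul_sub (fun _ => 1) (rankProb π) (m + 2)
  have h2 := sum_mul_eq_sum_partial_mul_sub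
    (fun k => (-1 : ℝ) ^ k * ((m + 1).choose k : ℝ)) (rankProb π) (m + 2)
  have h3 := Finset.sum_range_sub' (rankProb π) (m + 2)
  simp only [sum_range_alternating_choose, hend, mul_zero, add_zero, one_mul, Finset.sum_const,
    Finset.card_range, nsmul_eq_mul, mul_one, sub_zero] at h1 h2 h3
  rw [cumProb, alternatingSum, h1]
  simp only [show m + 2 - 1 = m + 1 from rfl, h2]
  rw [← h3, Finset.mul_sum, Finset.mul_sum, ← Finset.sum_add_distrib, ← Finset.sum_sub_distrib]
  refine Finset.sum_congr rfl fun k _ => ?_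
  simp only [dualSlack, Nat.add_sub_cancel]
  push_cast
  ring

lemma dualSlack_zero (n : ℕ) (δ : ℝ) : dualSlack n δ 0 = 0 := by simp [dualSlack]

lemma dualSlack_pos_of_even (hn : 3 ≤ n) {δ : ℝ} (h0 : 0 ≤ δ) (hδ : δ * n ≤ 1) {k : ℕ}
    (hk : 1 ≤ k) (he : Even k) : 0 < dualSlack n δ k := by
  have hk2 : 2 ≤ k := by obtain ⟨r, rfl⟩ := he; omega
  have hn' : (3 : ℝ) ≤ n := by exact_mod_cast hn
  have hk' : (2 : ℝ) ≤ k := by exact_mod_cast hk2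
  have h3 : δ * 3 ≤ 1 := (mul_le_mul_of_nonneg_left hn' h0).trans hδ
  have hC : 0 ≤ δ * ((n - 2).choose k : ℝ) := by positivity
  rw [dualSlack, he.neg_one_pow, one_mul]
  nlinarith

lemma dualSlack_last_pos (hn : 3 ≤ n) {δ : ℝ} (hδ : δ * n ≤ 1) :
    0 < dualSlack n δ (n - 1) := by
  have hn' : (3 : ℝ) ≤ n := by exact_mod_cast hn
  rw [dualSlack, Nat.choose_eq_zero_of_lt (show n - 2 < n - 1 by omega),
    Nat.cast_sub (by omega)]
  push_cast
  nlinarith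

lemma dualSlack_of_odd {δ : ℝ} {k : ℕ} (ho : Odd k) :
    dualSlack n δ k = k - δ * (((n - 2).choose k : ℝ) + (k + 1)) := by
  rw [dualSlack, ho.neg_one_pow]
  ring

lemma objective_succ (n k : ℕ) :
    objective n (k + 1) = k / (((n - 2).choose k : ℝ) + (k + 1)) := by
  simp [objective]

lemma objective_nonneg {i : ℕ} (n : ℕ) (hi : 1 ≤ i) : 0 ≤ objective n i := by
  obtain ⟨k, rfl⟩ : ∃ k, i = k + 1 := ⟨i - 1, by omega⟩
  rw [objective_succ]
  positivity

lemma two_mem_candidates (hn : 3 ≤ n) : 2 ∈ candidates n :=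
  ⟨le_rfl, by omega, even_two⟩

lemma argminSet_nonempty (hn : 3 ≤ n) : (argminSet n).Nonempty := by
  have hfin : (candidates n).Finite := (Set.finite_Iic n).subset fun i hi => by
    have := hi.2.1
    simp only [Set.mem_Iic]
    omega
  obtain ⟨ℓ, hℓ, h⟩ := Set.exists_min_image (candidates n) (objective n) hfin
    ⟨2, two_mem_candidates hn⟩
  exact ⟨ℓ, hℓ, h⟩

lemma objective_mul_le_one (hn : 3 ≤ n) {ℓ : ℕ} (hℓ : ℓ ∈ argminSet n) :
    objective n ℓ * n ≤ 1 := by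
  have h := hℓ.2 2 (two_mem_candidates hn)
  have h2 : objective n 2 = 1 / n := by
    rw [objective_succ n 1, Nat.choose_one_right, Nat.cast_sub (by omega)]
    push_cast
    congr 1
    ring
  have hn' : (0 : ℝ) < n := by exact_mod_cast (by omega : 0 < n)
  rw [h2] at h
  rwa [le_div_iff₀ hn'] at h

/-- The minimum of the objective is dual feasible, and the dual constraint at `k + 1` equal ranks
is tight only for `k = 0` and for minimizers `k + 1`. -/
lemma dualSlack_nonneg_and (hn : 3 ≤ n) {ℓ : ℕ} (hℓ : ℓ ∈ argminSet n) {k : ℕ} (hk : k < n) :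
    0 ≤ dualSlack n (objective n ℓ) k ∧
      (dualSlack n (objective n ℓ) k = 0 → k = 0 ∨ k + 1 ∈ argminSet n) := by
  have hδ := objective_mul_le_one hn hℓ
  have h0 := objective_nonneg n (show 1 ≤ ℓ from one_le_two.trans hℓ.1.1)
  rcases Nat.eq_zero_or_pos k with rfl | hpos
  · simp [dualSlack_zero]
  rcases Nat.even_or_odd k with he | ho
  · have := dualSlack_pos_of_even hn h0 hδ hpos he
    exact ⟨this.le, fun h => absurd h this.ne'⟩
  by_cases hlast : k = n - 1
  · have := dualSlack_last_pos hn hδ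
    rw [hlast]
    exact ⟨this.le, fun h => absurd h this.ne'⟩
  have hc : k + 1 ∈ candidates n := ⟨by omega, by omega, ho.add_one⟩
  have hD : (0 : ℝ) < ((n - 2).choose k : ℝ) + (k + 1) := by positivity
  rw [dualSlack_of_odd ho]
  constructor
  · have := hℓ.2 _ hc
    rw [objective_succ, le_div_iff₀ hD] at this
    linarith
  · refine fun h => Or.inr ⟨hc, fun i hi => ?_⟩
    have : objective n (k + 1) = objective n ℓ := by
      rw [objective_succ, div_eq_iff hD.ne']
      linarith
    rw [this]
    exact hℓ.2 i hi

/-! ### The minimizer is unique unless `n = 8` -/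

lemma choose_add_two_mul (m k : ℕ) :
    m.choose (k + 2) * ((k + 1) * (k + 2)) = m.choose k * ((m - k) * (m - k - 1)) := by
  have h1 := Nat.choose_succ_right_eq m k
  have h2 := Nat.choose_succ_right_eq m (k + 1)
  rw [show m - k - 1 = m - (k + 1) by omega]
  calc m.choose (k + 2) * ((k + 1) * (k + 2))
      = (m.choose (k + 1 + 1) * (k + 1 + 1)) * (k + 1) := by ring
    _ = (m.choose (k + 1) * (k + 1)) * (m - (k + 1)) := by rw [h2]; ring
    _ = _ := by rw [h1]; ring

/-- Once `C(m, k) / k` does not increase in a step of two, it never increases again: the condition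
is `C(m, k + 2) / (k + 2) ≤ C(m, k) / k` after cancelling `C(m, k)`. -/
lemma ratio_condition_succ {m k : ℕ} (hk : 1 ≤ k)
    (h : k * ((m - k) * (m - k - 1)) ≤ (k + 1) * (k + 2) ^ 2) :
    (k + 1) * ((m - (k + 1)) * (m - (k + 1) - 1)) ≤ (k + 2) * (k + 3) ^ 2 := by
  have h1 : (m - (k + 1)) * (m - (k + 1) - 1) ≤ (m - k) * (m - k - 1) :=
    Nat.mul_le_mul (by omega) (by omega)
  have h2 : k * ((k + 1) * ((m - (k + 1)) * (m - (k + 1) - 1)))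
      ≤ k * ((k + 2) * (k + 3) ^ 2) := by
    calc k * ((k + 1) * ((m - (k + 1)) * (m - (k + 1) - 1)))
        ≤ k * ((k + 1) * ((m - k) * (m - k - 1))) := by gcongr
      _ = (k + 1) * (k * ((m - k) * (m - k - 1))) := by ring
      _ ≤ (k + 1) * ((k + 1) * (k + 2) ^ 2) := by gcongr
      _ ≤ k * ((k + 2) * (k + 3) ^ 2) := by nlinarith
  exact Nat.le_of_mul_le_mul_left h2 (by omega)

lemma ratio_condition_add {m k : ℕ} (hk : 1 ≤ k)
    (h : k * ((m - k) * (m - k - 1)) ≤ (k + 1) * (k + 2) ^ 2) (t : ℕ) :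
    (k + t) * ((m - (k + t)) * (m - (k + t) - 1)) ≤ (k + t + 1) * (k + t + 2) ^ 2 := by
  induction t with
  | zero => simpa using h
  | succ t ih => exact ratio_condition_succ (k := k + t) (by omega) ih

lemma mul_choose_le_of_ratio_condition {m k : ℕ} (hk : 1 ≤ k)
    (h : k * ((m - k) * (m - k - 1)) ≤ (k + 1) * (k + 2) ^ 2) (t : ℕ) :
    k * m.choose (k + 2 * t) ≤ (k + 2 * t) * m.choose k := by
  induction t with
  | zero => simp
  | succ t ih =>
    have hr := ratio_condition_add hk h (2 * t)
    set l := k + 2 * t with hl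
    have hstep : l * m.choose (l + 2) ≤ (l + 2) * m.choose l := by
      refine Nat.le_of_mul_le_mul_right (c := (l + 1) * (l + 2)) ?_ (by positivity)
      calc l * m.choose (l + 2) * ((l + 1) * (l + 2))
          = m.choose l * (l * ((m - l) * (m - l - 1))) := by
            rw [mul_assoc, choose_add_two_mul]; ring
        _ ≤ m.choose l * ((l + 1) * (l + 2) ^ 2) := by gcongr
        _ = _ := by ring
    rw [show k + 2 * (t + 1) = l + 2 by omega]
    refine Nat.le_of_mul_le_mul_left (c := l) ?_ (by omega)
    calc l * (k * m.choose (l + 2)) = k * (l * m.choose (l + 2)) := by ring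
      _ ≤ k * ((l + 2) * m.choose l) := by gcongr
      _ = (l + 2) * (k * m.choose l) := by ring
      _ ≤ (l + 2) * (l * m.choose k) := by gcongr
      _ = _ := by ring

lemma lt_choose_of_three_le {j : ℕ} (hj : 3 ≤ j) :
    2 * ((j + 1) * (j + 2)) < (j + 6).choose j := by
  have h : (j + 6).choose j * 720 = (j + 6) * (j + 5) * (j + 4) * (j + 3) * (j + 2) * (j + 1) := by
    have := Nat.descFactorial_eq_factorial_mul_choose (j + 6) 6
    rw [Nat.choose_symm_add]
    simp only [Nat.descFactorial, Nat.factorial] at this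
    norm_num at this
    rw [show j + 6 - 5 = j + 1 by omega, show j + 6 - 4 = j + 2 by omega,
      show j + 6 - 3 = j + 3 by omega, show j + 6 - 2 = j + 4 by omega] at this
    linarith
  have h1 : 1440 < (j + 6) * (j + 5) * (j + 4) * (j + 3) := by
    calc 1440 < (3 + 6) * (3 + 5) * (3 + 4) * (3 + 3) := by norm_num
      _ ≤ _ := by gcongr
  have h2 : 1440 * ((j + 1) * (j + 2))
      < (j + 6) * (j + 5) * (j + 4) * (j + 3) * ((j + 1) * (j + 2)) := by gcongr
  nlinarith

/-- If the step from `j` to `j + 2` does not increase `(C(m, j) + 1) / j`, then it does not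
increase `C(m, j) / j` either; `m = 6`, `j = 1` is the only exception. The difference of the two
comparisons is `2`, which is too small to matter beside a multiple of `C(m, j)`. -/
lemma ratio_condition_of_le {m j : ℕ} (hm : m ≠ 6) (hj : Odd j)
    (h : j * (m.choose (j + 2) + 1) ≤ (j + 2) * (m.choose j + 1)) :
    j * ((m - j) * (m - j - 1)) ≤ (j + 1) * (j + 2) ^ 2 := by
  by_contra! hlt
  have h1 : m.choose j * (j * ((m - j) * (m - j - 1)))
      ≤ m.choose j * ((j + 1) * (j + 2) ^ 2) + 2 * ((j + 1) * (j + 2)) := by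
    have := choose_add_two_mul m j
    calc m.choose j * (j * ((m - j) * (m - j - 1)))
        = j * m.choose (j + 2) * ((j + 1) * (j + 2)) := by rw [mul_assoc, this]; ring
      _ ≤ ((j + 2) * m.choose j + 2) * ((j + 1) * (j + 2)) := by
        refine Nat.mul_le_mul_right _ ?_
        linarith
      _ = _ := by ring
  have h2 : m.choose j ≤ 2 * ((j + 1) * (j + 2)) := by
    have := Nat.mul_le_mul_left (m.choose j) hlt
    rw [Nat.succ_eq_add_one, mul_add, mul_one] at this
    omega
  have hpos : 1 ≤ j := hj.pos
  by_cases hj1 : j = 1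
  · subst hj1
    norm_num at h1 h2 hlt
    -- `h2` says `m ≤ 12`, a finite check
    interval_cases m <;> omega
  · have hj3 : 3 ≤ j := by obtain ⟨r, rfl⟩ := hj; omega
    -- `m` is so large that `C(m, j) ≥ C(j + 6, j)` exceeds the bound in `h2`
    have hm' : 2 * j + 3 ≤ m := by
      by_contra! hcon
      have : (m - j) * (m - j - 1) ≤ (j + 2) * (j + 1) :=
        Nat.mul_le_mul (by omega) (by omega)
      have := Nat.mul_le_mul_left j this
      nlinarith
    have := Nat.choose_le_choose j (show j + 6 ≤ m by omega)
    have := lt_choose_of_three_le hj3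
    omega

lemma objective_le_objective_iff {n j k : ℕ} :
    objective n (j + 1) ≤ objective n (k + 1) ↔
      j * ((n - 2).choose k + 1) ≤ k * ((n - 2).choose j + 1) := by
  rw [objective_succ, objective_succ, div_le_div_iff₀ (by positivity) (by positivity)]
  rw [← Nat.cast_le (α := ℝ)]
  push_cast
  constructor <;> intro h <;> linarith

/-- The minimizer is unique for `n ≠ 8`. If `ℓ` is a minimizer, then beyond it the sequence
`C(n - 2, i - 1) / (i - 1)` is nonincreasing, so that the objective is strictly larger there. -/
lemma argminSet_not_lt (hn : 3 ≤ n) (h8 : n ≠ 8) {ℓ i : ℕ} (hℓ : ℓ ∈ argminSet n)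
    (hi : i ∈ argminSet n) : ¬ ℓ < i := by
  intro hlt
  obtain ⟨⟨hℓ2, -, hℓe⟩, hℓmin⟩ := hℓ
  obtain ⟨⟨-, hin, hie⟩, himin⟩ := hi
  have hℓi := himin ℓ ⟨hℓ2, by omega, hℓe⟩
  obtain ⟨j, rfl⟩ : ∃ j, ℓ = j + 1 := ⟨ℓ - 1, by omega⟩
  obtain ⟨t, rfl⟩ : ∃ t, i = j + 2 * t + 1 := by
    obtain ⟨a, ha⟩ := hℓe
    obtain ⟨b, hb⟩ := hie
    exact ⟨b - a, by omega⟩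
  have hj : Odd j := by
    obtain ⟨a, ha⟩ := hℓe
    exact ⟨a - 1, by omega⟩
  have hstep := hℓmin (j + 2 + 1) ⟨by omega, by omega, by
    obtain ⟨a, ha⟩ := hℓe
    exact ⟨a + 1, by omega⟩⟩
  rw [objective_le_objective_iff] at hstep hℓi
  have h := mul_choose_le_of_ratio_condition hj.pos
    (ratio_condition_of_le (by omega) hj hstep) t
  rw [mul_add, mul_add] at hℓi
  omega

lemma argminSet_subsingleton (hn : 3 ≤ n) (h8 : n ≠ 8) : (argminSet n).Subsingleton :=
  fun _ hℓ _ hi => le_antisymm (not_lt.mp (argminSet_not_lt hn h8 hi hℓ))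
    (not_lt.mp (argminSet_not_lt hn h8 hℓ hi))

/-! ### Necessity of the alternating sum condition -/

/-- The lowest valuation. -/
def lowVal (hβ : 0 < β) : Valuation β := ⟨0, le_rfl, hβ.le⟩

/-- The highest valuation. -/
def highVal (hβ : 0 < β) : Valuation β := ⟨β, hβ.le, le_rfl⟩

/-- Revenue equivalence for one agent whose probability is constant at interior reports: the
utilities at the two extreme valuations differ by `β * c`. No integrals are needed, as the
comparisons with interior reports close to `0` and to `β` suffice. -/
lemma utility_high_sub_low (hβ : 0 < β) {g q : Valuation β → ℝ} {c : ℝ}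
    (hg : ∀ x, g x ∈ Set.Icc (0 : ℝ) 1) (hc : c ∈ Set.Icc (0 : ℝ) 1)
    (hgc : ∀ x : Valuation β, 0 < (x : ℝ) → (x : ℝ) < β → g x = c)
    (h : ∀ x y : Valuation β, (x : ℝ) * g y - q y ≤ x * g x - q x) :
    (β * g (highVal hβ) - q (highVal hβ)) - (0 * g (lowVal hβ) - q (lowVal hβ)) = β * c := by
  have hg0 := hg (lowVal hβ)
  have hgb := hg (highVal hβ)
  have hlow : ∀ y : ℝ, 0 < y → y < β → β * c - y ≤
      (β * g (highVal hβ) - q (highVal hβ)) - (0 * g (lowVal hβ) - q (lowVal hβ)) := by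
    intro y h0 h1
    set y' : Valuation β := ⟨y, h0.le, h1.le⟩
    have e1 := h (highVal hβ) y'
    have e2 := h y' (lowVal hβ)
    rw [hgc y' h0 h1] at e1 e2
    simp only [highVal, lowVal, y'] at *
    nlinarith [mul_nonneg h0.le hg0.1, mul_nonneg h0.le (sub_nonneg.mpr hc.2)]
  have hupp : ∀ y : ℝ, 0 < y → y < β →
      (β * g (highVal hβ) - q (highVal hβ)) - (0 * g (lowVal hβ) - q (lowVal hβ))
        ≤ β * c + (β - y) := by
    intro y h0 h1
    set y' : Valuation β := ⟨y, h0.le, h1.le⟩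
    have e1 := h (lowVal hβ) y'
    have e2 := h y' (highVal hβ)
    rw [hgc y' h0 h1] at e1 e2
    simp only [highVal, lowVal, y'] at *
    nlinarith [mul_nonneg (sub_nonneg.mpr h1.le) (sub_nonneg.mpr hgb.2),
      mul_nonneg (sub_nonneg.mpr h1.le) hc.1]
  refine le_antisymm (le_of_forall_pos_le_add fun ε hε => ?_)
    (le_of_forall_pos_le_add fun ε hε => ?_)
  · have hm : 0 < min ε (β / 2) := lt_min hε (by positivity)
    have hm1 := min_le_left ε (β / 2)
    have hm2 := min_le_right ε (β / 2)
    have := hupp (β - min ε (β / 2)) (by linarith) (by linarith)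
    linarith
  · have hm : 0 < min ε (β / 2) := lt_min hε (by positivity)
    have hm1 := min_le_left ε (β / 2)
    have hm2 := min_le_right ε (β / 2)
    have := hlow (min ε (β / 2)) hm (by linarith)
    linarith

/-- The profile in which the agents of `T` have the highest valuation and all others the lowest
one. -/
def extremeProfile (hβ : 0 < β) (T : Finset (Fin n)) : Profile n β :=
  fun i => if i ∈ T then highVal hβ else lowVal hβ

lemma isUpperAgents_extremeProfile (hβ : 0 < β) (T : Finset (Fin n)) :
    IsUpperAgents (extremeProfile hβ T) T := by
  intro i hi j hij
  by_contra hj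
  simp only [extremeProfile, hi, hj, if_true, if_false, highVal, lowVal] at hij
  exact absurd hij (not_le.mpr hβ)

lemma numOthersAbove_extremeProfile (hβ : 0 < β) (T : Finset (Fin n)) (i : Fin n) {x : ℝ}
    (h0 : 0 ≤ x) (h1 : x < β) :
    numOthersAbove (extremeProfile hβ T) i x = (T.erase i).card := by
  unfold numOthersAbove
  congr 1
  ext j
  simp only [Finset.mem_filter, Finset.mem_erase, Finset.mem_univ, and_true]
  by_cases hj : j ∈ T <;> simp [extremeProfile, hj, highVal, lowVal, h0, h1]

/-- The utility of agent `i` at the extreme profile of `T`. -/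
def extremeUtility (f : AllocationRule n β) (p : PaymentRule n β) (hβ : 0 < β)
    (T : Finset (Fin n)) (i : Fin n) : ℝ :=
  (extremeProfile hβ T i : ℝ) * f.prob (extremeProfile hβ T) i - p (extremeProfile hβ T) i

lemma extremeUtility_sub_erase {f : AllocationRule n β} {p : PaymentRule n β} {π : Fin n → ℝ}
    (hβ : 0 < β) (hf : IsRanking f π) (hp : IsDSIC f p) {T : Finset (Fin n)} {i : Fin n}
    (hi : i ∈ T) :
    extremeUtility f p hβ T i - extremeUtility f p hβ (T.erase i) i
      = β * rankProb π (T.card - 1) := by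
  have ha := rankProb_antitone hf.mem_Icc hf.antitone
  have hhigh : Function.update (extremeProfile hβ T) i (highVal hβ) = extremeProfile hβ T := by
    rw [Function.update_eq_self_iff]
    simp [extremeProfile, hi]
  have hlow : Function.update (extremeProfile hβ T) i (lowVal hβ)
      = extremeProfile hβ (T.erase i) := by
    ext j
    by_cases hj : j = i
    · subst hj; simp [extremeProfile]
    · simp [extremeProfile, hj]
  have key := utility_high_sub_low hβ
    (g := fun x => f.prob (Function.update (extremeProfile hβ T) i x) i)
    (q := fun x => p (Function.update (extremeProfile hβ T) i x) i)
    (c := rankProb π (T.card - 1))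
    (fun x => f.prob_mem _ _) ⟨rankProb_nonneg hf.mem_Icc _, rankProb_le_one hf.mem_Icc _⟩
    (fun y h0 h1 => ?_) (fun x y => ?_)
  · simp only [hhigh, hlow] at key
    have e1 : (extremeProfile hβ T i : ℝ) = β := by simp [extremeProfile, hi, highVal]
    have e2 : (extremeProfile hβ (T.erase i) i : ℝ) = 0 := by simp [extremeProfile, lowVal]
    rw [extremeUtility, extremeUtility, e1, e2, key]
  · have hcard := Finset.card_erase_of_mem hi
    have hq := hf.card_tied_mul (Function.update (extremeProfile hβ T) i y) i
    refine le_antisymm ?_ ?_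
    · have := le_rankProb_numOthersAbove ha hq (x := (y : ℝ)) (by simp)
      rwa [numOthersAbove_update, numOthersAbove_extremeProfile hβ T i h0.le h1, hcard] at this
    · have := rankProb_numOthersAbove_le ha hq (x := 0) (by simpa using h0)
      rwa [numOthersAbove_update, numOthersAbove_extremeProfile hβ T i le_rfl hβ, hcard] at this
  · have := hp i (Function.update (extremeProfile hβ T) i x) y
    simpa using this

lemma sum_extremeUtility_erase {f : AllocationRule n β} {p : PaymentRule n β} {π : Fin n → ℝ}
    (hβ : 0 < β) (hf : IsRanking f π) (hp : IsDSIC f p) (hb : IsBudgetBalanced p)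
    (T : Finset (Fin n)) :
    ∑ i, extremeUtility f p hβ (T.erase i) i = β * residual π T.card := by
  have h1 : ∑ i, extremeUtility f p hβ T i = β * cumProb π T.card := by
    simp only [extremeUtility, Finset.sum_sub_distrib]
    rw [hb, sub_zero, ← hf.sum_upper (isUpperAgents_extremeProfile hβ T), Finset.mul_sum,
      ← Finset.sum_subset (Finset.subset_univ T)]
    · refine Finset.sum_congr rfl fun i hi => ?_
      congr 1
      simp [extremeProfile, hi, highVal]
    · intro i _ hi
      simp [extremeProfile, hi, lowVal]
  have h2 : ∑ i, (extremeUtility f p hβ T i - extremeUtility f p hβ (T.erase i) i)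
      = T.card * (β * rankProb π (T.card - 1)) := by
    rw [← Finset.sum_subset (Finset.subset_univ T)]
    · rw [Finset.sum_congr rfl fun i hi => extremeUtility_sub_erase hβ hf hp hi]
      simp
    · intro i _ hi
      rw [Finset.erase_eq_of_notMem hi, sub_self]
  rw [Finset.sum_sub_distrib, h1] at h2
  rw [residual]
  linarith

lemma sum_alternating_erase (i : Fin n) (u : Finset (Fin n) → ℝ) :
    ∑ T : Finset (Fin n), (-1 : ℝ) ^ T.card * u (T.erase i) = 0 := by
  rw [← Finset.powerset_univ, ← Finset.insert_erase (Finset.mem_univ i),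
    Finset.sum_powerset_insert (Finset.notMem_erase i _), ← Finset.sum_add_distrib]
  refine Finset.sum_eq_zero fun T hT => ?_
  have hi : i ∉ T := fun h => Finset.notMem_erase i _ (Finset.mem_powerset.mp hT h)
  rw [Finset.card_insert_of_notMem hi, Finset.erase_insert hi, Finset.erase_eq_of_notMem hi]
  ring

/-- Budget balance at all extreme profiles forces the alternating sum to vanish: utilities net of
information rents do not depend on the own report, so they cancel from the sum over all
extreme profiles with alternating signs. -/
lemma alternatingSum_eq_zero_of_implementable (hn : 2 ≤ n) (hβ : 0 < β)
    {f : AllocationRule n β} {π : Fin n → ℝ} (hf : IsRanking f π)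
    (hi : IsSatisfactorilyImplementable f) : alternatingSum π = 0 := by
  obtain ⟨p, hp⟩ := hi
  have h1 : ∑ T : Finset (Fin n), (-1 : ℝ) ^ T.card * (β * residual π T.card) = 0 := by
    simp only [← sum_extremeUtility_erase hβ hf hp.dsic hp.budgetBalanced, Finset.mul_sum]
    rw [Finset.sum_comm]
    exact Finset.sum_eq_zero fun i _ =>
      sum_alternating_erase i fun T => extremeUtility f p hβ T i
  rw [← Finset.powerset_univ,
    Finset.sum_powerset_apply_card (fun k => (-1 : ℝ) ^ k * (β * residual π k)),
    Finset.card_univ, Fintype.card_fin] at h1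
  have h2 : β * (((n : ℝ) - 1) * alternatingSum π) = 0 := by
    rw [← sum_alternating_choose_mul_residual (by omega) π, Finset.mul_sum, ← h1]
    refine Finset.sum_congr rfl fun k _ => ?_
    rw [nsmul_eq_mul]
    ring
  have hn' : (n : ℝ) - 1 ≠ 0 := by
    have : (2 : ℝ) ≤ n := by exact_mod_cast hn
    linarith
  exact (mul_eq_zero.mp ((mul_eq_zero.mp h2).resolve_left hβ.ne')).resolve_left hn'

/-! ### Sufficiency of the alternating sum condition -/

/-- The rate, per unit of valuation, at which an agent is compensated when `k` of the others are
above the current level. -/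
noncomputable def compensation (π : Fin n → ℝ) (k : ℕ) : ℝ :=
  (-1) ^ k * (∑ j ∈ Finset.range (k + 1), (-1 : ℝ) ^ j * (n.choose j : ℝ) * residual π j)
    / (((n : ℝ) - k) * (n.choose k : ℝ))

/-- If `k` agents are above the current level, then the compensations add up to the residual. -/
lemma compensation_balance (hn : 1 ≤ n) {π : Fin n → ℝ} (hS : alternatingSum π = 0) {k : ℕ}
    (hk : k ≤ n) :
    k * compensation π (k - 1) + ((n : ℝ) - k) * compensation π k = residual π k := by
  set P : ℕ → ℝ :=
    fun k => ∑ j ∈ Finset.range k, (-1 : ℝ) ^ j * (n.choose j : ℝ) * residual π j with hP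
  have hCpos : ∀ {k : ℕ}, k ≤ n → (n.choose k : ℝ) ≠ 0 := fun h => by
    exact_mod_cast (Nat.choose_pos h).ne'
  have hPsucc : P (k + 1) = P k + (-1 : ℝ) ^ k * (n.choose k : ℝ) * residual π k :=
    Finset.sum_range_succ _ _
  have hsq : ((-1 : ℝ) ^ k) * (-1) ^ k = 1 := by rw [← mul_pow]; norm_num
  have h1 : ((n : ℝ) - k) * compensation π k = (-1) ^ k * P (k + 1) / (n.choose k : ℝ) := by
    rcases hk.eq_or_lt with rfl | hlt
    · have : P (k + 1) = 0 := by
        rw [hP]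
        simp only
        rw [sum_alternating_choose_mul_residual hn, hS, mul_zero]
      rw [this]
      simp
    · have hne : (n : ℝ) - k ≠ 0 := sub_ne_zero.mpr (by exact_mod_cast hlt.ne')
      have := hCpos hk
      rw [compensation]
      field_simp
      rfl
  have h2 : (k : ℝ) * compensation π (k - 1) = -((-1) ^ k * P k / (n.choose k : ℝ)) := by
    rcases Nat.eq_zero_or_pos k with rfl | hpos
    · simp [hP]
    · obtain ⟨l, rfl⟩ : ∃ l, k = l + 1 := ⟨k - 1, by omega⟩
      have hc : (n.choose (l + 1) : ℝ) * ((l : ℝ) + 1) = n.choose l * ((n : ℝ) - l) := by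
        have := Nat.choose_succ_right_eq n l
        rw [← Nat.cast_sub (by omega)]
        exact_mod_cast this
      have hne : (n : ℝ) - l ≠ 0 := sub_ne_zero.mpr (by
        exact_mod_cast (by omega : n ≠ l))
      have hA := hCpos hk
      have hB := hCpos (show l ≤ n by omega)
      simp only [compensation, Nat.add_sub_cancel]
      rw [mul_div_assoc', eq_neg_iff_add_eq_zero, div_add_div _ _ (mul_ne_zero hne hB) hA,
        div_eq_zero_iff]
      left
      push_cast
      rw [pow_succ]
      linear_combination (-1) ^ l * P (l + 1) * hc
  rw [h1, h2, hPsucc]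
  have := hCpos hk
  field_simp
  linear_combination (n.choose k : ℝ) * residual π k * hsq

/-- The number of agents whose valuation exceeds `x`. -/
noncomputable def numAbove (v : Profile n β) (x : ℝ) : ℕ :=
  (Finset.univ.filter fun j => x < (v j : ℝ)).card

lemma numOthersAbove_of_lt {v : Profile n β} {i : Fin n} {x : ℝ} (h : x < v i) :
    numOthersAbove v i x = numAbove v x - 1 := by
  rw [numOthersAbove, numAbove, Finset.filter_erase, Finset.card_erase_of_mem (by simpa using h)]

lemma numOthersAbove_of_le {v : Profile n β} {i : Fin n} {x : ℝ} (h : v i ≤ x) :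
    numOthersAbove v i x = numAbove v x := by
  rw [numOthersAbove, numAbove, Finset.filter_erase, Finset.erase_eq_of_notMem (by simpa using h)]

/-- The contribution of the level `x` to the payment of agent `i`: the value of the object, less
the information rent, less the compensation. -/
noncomputable def levelPayment (f : AllocationRule n β) (π : Fin n → ℝ) (v : Profile n β)
    (i : Fin n) (x : ℝ) : ℝ :=
  (if x < v i then f.prob v i - rankProb π (numOthersAbove v i x) else 0)
    - compensation π (numOthersAbove v i x)

/-- The payment rule that implements a ranking allocation rule. -/
noncomputable def rankingPayment (f : AllocationRule n β) (π : Fin n → ℝ) : PaymentRule n β :=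
  fun v i => ∫ x in (0 : ℝ)..β, levelPayment f π v i x

/-- At each level the payments add up to zero. -/
lemma sum_levelPayment (hn : 1 ≤ n) {f : AllocationRule n β} {π : Fin n → ℝ}
    (hf : IsRanking f π) (hS : alternatingSum π = 0) (v : Profile n β) (x : ℝ) :
    ∑ i, levelPayment f π v i x = 0 := by
  set A : Finset (Fin n) := Finset.univ.filter fun j => x < (v j : ℝ) with hA
  have hup : IsUpperAgents v A := by
    intro i hi j hij
    simp only [hA, Finset.mem_filter, Finset.mem_univ, true_and] at hi ⊢
    exact hi.trans_le hij
  have hcard : numAbove v x = A.card := rfl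
  have h1 : ∑ i ∈ A, levelPayment f π v i x = ∑ i ∈ A, (f.prob v i
      - (rankProb π (A.card - 1) + compensation π (A.card - 1))) := by
    refine Finset.sum_congr rfl fun i hi => ?_
    have hx : x < v i := (Finset.mem_filter.mp hi).2
    rw [levelPayment, if_pos hx, numOthersAbove_of_lt hx, hcard]
    ring
  have h2 : ∑ i ∈ Aᶜ, levelPayment f π v i x = ∑ i ∈ Aᶜ, -compensation π A.card := by
    refine Finset.sum_congr rfl fun i hi => ?_
    have hx : ¬ x < v i := fun h => Finset.mem_compl.mp hi (by simpa [hA] using h)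
    rw [levelPayment, if_neg hx, numOthersAbove_of_le (not_lt.mp hx), hcard]
    ring
  have hle : A.card ≤ n := by simpa using Finset.card_le_univ A
  have hb := compensation_balance hn hS hle
  rw [← Finset.sum_add_sum_compl A, h1, h2, Finset.sum_sub_distrib, hf.sum_upper hup,
    Finset.sum_const, Finset.sum_const, Finset.card_compl, Fintype.card_fin, nsmul_eq_mul,
    nsmul_eq_mul, Nat.cast_sub hle]
  rw [residual] at hb
  linarith

lemma intervalIntegrable_of_bounded {g : ℝ → ℝ} (hm : Measurable g) {C : ℝ}
    (hC : ∀ x, |g x| ≤ C) (a b : ℝ) : IntervalIntegrable g MeasureTheory.volume a b :=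
  (intervalIntegrable_const (c := C)).mono_fun hm.aestronglyMeasurable
    (Filter.Eventually.of_forall fun x => (hC x).trans (le_abs_self C))

lemma measurable_numOthersAbove (v : Profile n β) (i : Fin n) :
    Measurable fun x => numOthersAbove v i x := by
  refine Antitone.measurable fun x y hxy => Finset.card_le_card fun j hj => ?_
  simp only [Finset.mem_filter] at hj ⊢
  exact ⟨hj.1, hxy.trans_lt hj.2⟩

lemma abs_apply_numOthersAbove_le (F : ℕ → ℝ) (v : Profile n β) (i : Fin n) (x : ℝ) :
    |F (numOthersAbove v i x)| ≤ ∑ k ∈ Finset.range (n + 1), |F k| := by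
  refine Finset.single_le_sum (f := fun k => |F k|) (fun _ _ => abs_nonneg _) ?_
  have : numOthersAbove v i x ≤ n :=
    (Finset.card_le_univ _).trans_eq (Fintype.card_fin n)
  exact Finset.mem_range.mpr (by omega)

lemma intervalIntegrable_apply_numOthersAbove (F : ℕ → ℝ) (v : Profile n β) (i : Fin n) :
    IntervalIntegrable (fun x => F (numOthersAbove v i x)) MeasureTheory.volume 0 β :=
  intervalIntegrable_of_bounded ((measurable_from_nat (f := F)).comp
    (measurable_numOthersAbove v i)) (abs_apply_numOthersAbove_le F v i) 0 β

lemma intervalIntegrable_ite_numOthersAbove (F : ℕ → ℝ) (v : Profile n β) (i : Fin n) (w : ℝ) :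
    IntervalIntegrable (fun x => if x < w then F (numOthersAbove v i x) else 0)
      MeasureTheory.volume 0 β := by
  refine intervalIntegrable_of_bounded (Measurable.ite measurableSet_Iio
    ((measurable_from_nat (f := F)).comp (measurable_numOthersAbove v i)) measurable_const)
    (C := ∑ k ∈ Finset.range (n + 1), |F k|) (fun x => ?_) 0 β
  split_ifs
  · exact abs_apply_numOthersAbove_le F v i x
  · simpa using Finset.sum_nonneg fun k (_ : k ∈ Finset.range (n + 1)) => abs_nonneg (F k)

lemma intervalIntegrable_levelPayment (f : AllocationRule n β) (π : Fin n → ℝ)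
    (v : Profile n β) (i : Fin n) :
    IntervalIntegrable (levelPayment f π v i) MeasureTheory.volume 0 β :=
  (intervalIntegrable_ite_numOthersAbove (fun k => f.prob v i - rankProb π k) v i (v i)).sub
    (intervalIntegrable_apply_numOthersAbove (compensation π) v i)

lemma intervalIntegrable_ite_const (w c : ℝ) :
    IntervalIntegrable (fun x => if x < w then c else 0) MeasureTheory.volume 0 β := by
  refine intervalIntegrable_of_bounded (Measurable.ite measurableSet_Iio
    measurable_const measurable_const) (C := |c|) (fun x => ?_) 0 β
  split_ifs <;> simp

/-- The layer-cake formula for the value `w * c`. -/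
lemma integral_ite_lt (w : Valuation β) (c : ℝ) :
    ∫ x in (0 : ℝ)..β, (if x < (w : ℝ) then c else 0) = w * c := by
  have hw := w.2
  have hset : Set.Ioc 0 β ∩ Set.Iio (w : ℝ) = Set.Ioo 0 (w : ℝ) := by
    ext x
    simp only [Set.mem_inter_iff, Set.mem_Ioc, Set.mem_Iio, Set.mem_Ioo]
    exact ⟨fun h => ⟨h.1.1, h.2⟩, fun h => ⟨⟨h.1, h.2.le.trans hw.2⟩, h.2⟩⟩
  have hind : (fun x : ℝ => if x < (w : ℝ) then c else 0)
      = (Set.Iio (w : ℝ)).indicator fun _ => c := by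
    ext x
    simp [Set.indicator]
  rw [intervalIntegral.integral_of_le (hw.1.trans hw.2), hind,
    MeasureTheory.setIntegral_indicator measurableSet_Iio, hset,
    MeasureTheory.setIntegral_const]
  simp [hw.1]

lemma isDSIC_rankingPayment {f : AllocationRule n β} {π : Fin n → ℝ}
    (hf : IsRanking f π) : IsDSIC f (rankingPayment f π) := by
  intro i v y
  have ha := rankProb_antitone hf.mem_Icc hf.antitone
  have hβ : 0 ≤ β := y.2.1.trans y.2.2
  set v' := Function.update v i y with hv'
  have hv'i : v' i = y := Function.update_self i y v
  -- both utilities as integrals over levels, to be compared level by level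
  rw [rankingPayment, rankingPayment, ← integral_ite_lt (v i) (f.prob v' i),
    ← integral_ite_lt (v i) (f.prob v i),
    ← intervalIntegral.integral_sub (intervalIntegrable_ite_const _ _)
      (intervalIntegrable_levelPayment f π v' i),
    ← intervalIntegral.integral_sub (intervalIntegrable_ite_const _ _)
      (intervalIntegrable_levelPayment f π v i)]
  refine intervalIntegral.integral_mono_on hβ
    ((intervalIntegrable_ite_const _ _).sub (intervalIntegrable_levelPayment f π v' i))
    ((intervalIntegrable_ite_const _ _).sub (intervalIntegrable_levelPayment f π v i))
    fun x _ => ?_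
  have hq := hf.card_tied_mul v' i
  have hA : numOthersAbove v' i x = numOthersAbove v i x := numOthersAbove_update v i y x
  have h1 : x < y → rankProb π (numOthersAbove v i x) ≤ f.prob v' i := fun h => by
    rw [← hA]
    exact rankProb_numOthersAbove_le ha hq (by rwa [hv'i])
  have h2 : ¬ x < y → f.prob v' i ≤ rankProb π (numOthersAbove v i x) := fun h => by
    rw [← hA]
    exact le_rankProb_numOthersAbove ha hq (by rw [hv'i]; exact not_lt.mp h)
  simp only [levelPayment, hv'i, hA]
  by_cases hxy : x < y
  · have := h1 hxy
    by_cases hxv : x < v i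
    · simp only [hxy, hxv, if_true]; linarith
    · simp only [hxy, hxv, if_true, if_false]; linarith
  · have := h2 hxy
    by_cases hxv : x < v i
    · simp only [hxy, hxv, if_true, if_false]; linarith
    · simp only [hxy, hxv, if_false]; linarith

lemma isSatisfactory_rankingPayment (hn : 1 ≤ n) {f : AllocationRule n β} {π : Fin n → ℝ}
    (hf : IsRanking f π) (hS : alternatingSum π = 0) :
    IsSatisfactory f (rankingPayment f π) where
  dsic := isDSIC_rankingPayment hf
  budgetBalanced := fun v => by
    simp only [rankingPayment]
    rw [← intervalIntegral.integral_finsetSum fun i _ => intervalIntegrable_levelPayment f π v i]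
    simp [sum_levelPayment hn hf hS]
  symmetric_alloc := hf.symmetric
  symmetric_payment := by
    intro v i j hij
    have hA : ∀ x, numOthersAbove v i x = numOthersAbove v j x := fun x => by
      by_cases hx : x < v i
      · rw [numOthersAbove_of_lt hx, numOthersAbove_of_lt (hij ▸ hx)]
      · rw [numOthersAbove_of_le (not_lt.mp hx), numOthersAbove_of_le (hij ▸ not_lt.mp hx)]
    simp only [rankingPayment, levelPayment, hA, hij, hf.symmetric v i j hij]

/-! ### The optimal probabilities -/

lemma rankProb_optimalProb {ℓ : ℕ} (hℓ : 1 ≤ ℓ) (hℓn : ℓ ≤ n) (k : ℕ) :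
    rankProb (optimalProb n ℓ) k =
      (if k < 1 then ((n - 2).choose (ℓ - 1) : ℝ) / ((n - 2).choose (ℓ - 1) + (ℓ : ℝ)) else 0)
        + (if k < ℓ then 1 / ((n - 2).choose (ℓ - 1) + (ℓ : ℝ)) else 0) := by
  have hD : ((n - 2).choose (ℓ - 1) : ℝ) + (ℓ : ℝ) ≠ 0 := by positivity
  by_cases hk : k < n
  · rw [rankProb, dif_pos hk, optimalProb]
    rcases Nat.eq_zero_or_pos k with rfl | hpos
    · simp only [if_true, Nat.zero_lt_one, Nat.lt_of_lt_of_le Nat.zero_lt_one hℓ]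
      field_simp
      ring
    · simp [hpos.ne', show ¬ k < 1 by omega]
  · rw [rankProb_of_le _ (not_lt.mp hk), if_neg (by omega), if_neg (by omega), add_zero]

lemma sum_range_ite_lt (a : ℕ → ℝ) (c : ℝ) {ℓ n : ℕ} (h : ℓ ≤ n) :
    ∑ k ∈ Finset.range n, a k * (if k < ℓ then c else 0)
      = (∑ k ∈ Finset.range ℓ, a k) * c := by
  rw [Finset.sum_mul]
  symm
  refine (Finset.sum_congr rfl fun k hk => ?_).trans
    (Finset.sum_subset (Finset.range_mono h) fun k _ hk => ?_)
  · rw [if_pos (Finset.mem_range.mp hk)]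
  · rw [if_neg (fun hlt => hk (Finset.mem_range.mpr hlt)), mul_zero]

lemma alternatingSum_optimalProb {ℓ : ℕ} (hℓ : ℓ ∈ candidates n) :
    alternatingSum (optimalProb n ℓ) = 0 := by
  obtain ⟨h2, hln, he⟩ := hℓ
  obtain ⟨m, rfl⟩ : ∃ m, n = m + 2 := ⟨n - 2, by omega⟩
  obtain ⟨j, rfl⟩ : ∃ j, ℓ = j + 1 := ⟨ℓ - 1, by omega⟩
  have hj : Odd j := by
    obtain ⟨a, ha⟩ := he
    exact ⟨a - 1, by omega⟩
  simp only [alternatingSum, rankProb_optimalProb (show 1 ≤ j + 1 by omega)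
    (show j + 1 ≤ m + 2 by omega), mul_add, Finset.sum_add_distrib]
  rw [sum_range_ite_lt _ _ (by omega), sum_range_ite_lt _ _ (by omega),
    show m + 2 - 1 = m + 1 from rfl, sum_range_alternating_choose m j, hj.neg_one_pow]
  simp only [Finset.range_one, Finset.sum_singleton, Nat.add_sub_cancel]
  simp
  ring

lemma cumProb_optimalProb {ℓ : ℕ} (hℓ : ℓ ∈ candidates n) :
    cumProb (optimalProb n ℓ) n = 1 := by
  obtain ⟨h2, hln, -⟩ := hℓ
  have hD : ((n - 2).choose (ℓ - 1) : ℝ) + (ℓ : ℝ) ≠ 0 := by positivity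
  have h1 := sum_range_ite_lt (fun _ => 1)
    (((n - 2).choose (ℓ - 1) : ℝ) / ((n - 2).choose (ℓ - 1) + (ℓ : ℝ))) (show 1 ≤ n by omega)
  have h2 := sum_range_ite_lt (fun _ => 1)
    (1 / ((n - 2).choose (ℓ - 1) + (ℓ : ℝ))) (show ℓ ≤ n by omega)
  simp only [one_mul] at h1 h2
  simp only [cumProb, rankProb_optimalProb (show 1 ≤ ℓ by omega) (show ℓ ≤ n by omega),
    Finset.sum_add_distrib]
  rw [h1, h2]
  simp only [Finset.sum_const, Finset.card_range, nsmul_eq_mul]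
  field_simp
  push_cast
  ring

lemma optimalProb_antitone {ℓ : ℕ} (hℓ : ℓ ∈ candidates n) : Antitone (optimalProb n ℓ) := by
  obtain ⟨h2, hln, -⟩ := hℓ
  intro i j hij
  have hij' : i.val ≤ j.val := hij
  rw [← rankProb_val (optimalProb n ℓ) i, ← rankProb_val (optimalProb n ℓ) j,
    rankProb_optimalProb (by omega) (by omega),
    rankProb_optimalProb (by omega) (by omega)]
  have hC : (0 : ℝ) ≤ ((n - 2).choose (ℓ - 1) : ℝ) / ((n - 2).choose (ℓ - 1) + (ℓ : ℝ)) := by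
    positivity
  have hD : (0 : ℝ) ≤ 1 / ((n - 2).choose (ℓ - 1) + (ℓ : ℝ)) := by positivity
  refine add_le_add ?_ ?_ <;> split_ifs <;> first | exact le_rfl | assumption | omega

lemma optimalProb_nonneg {ℓ : ℕ} (hℓ : ℓ ∈ candidates n) (i : Fin n) :
    0 ≤ optimalProb n ℓ i := by
  obtain ⟨h2, hln, -⟩ := hℓ
  rw [← rankProb_val (optimalProb n ℓ) i, rankProb_optimalProb (by omega) (by omega)]
  positivity

lemma optimalProb_mem_Icc {ℓ : ℕ} (hℓ : ℓ ∈ candidates n) (i : Fin n) :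
    optimalProb n ℓ i ∈ Set.Icc (0 : ℝ) 1 := by
  refine ⟨optimalProb_nonneg hℓ i, ?_⟩
  rw [← cumProb_optimalProb hℓ, ← sum_eq_cumProb]
  exact Finset.single_le_sum (fun j _ => optimalProb_nonneg hℓ j) (Finset.mem_univ i)

lemma isTwoStepRanking_optimalProb {ℓ : ℕ} (hℓ : ℓ ∈ candidates n) {f : AllocationRule n β}
    (hf : IsRanking f (optimalProb n ℓ)) : IsTwoStepRanking f (optimalProb n ℓ) ℓ := by
  obtain ⟨h2, hln, -⟩ := hℓ
  have hℓ0 : (0 : ℝ) < ℓ := by exact_mod_cast (by omega : 0 < ℓ)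
  have hCpos : (0 : ℝ) < ((n - 2).choose (ℓ - 1) : ℝ) := by
    exact_mod_cast Nat.choose_pos (by omega)
  have hD : (0 : ℝ) < ((n - 2).choose (ℓ - 1) : ℝ) + (ℓ : ℝ) := by positivity
  refine ⟨hf, by omega, by omega,
    1 - ((ℓ : ℝ) - 1) / (((n - 2).choose (ℓ - 1) : ℝ) + (ℓ : ℝ)),
    1 / (((n - 2).choose (ℓ - 1) : ℝ) + (ℓ : ℝ)), ?_, by positivity, ?_, fun i => rfl⟩
  · rw [one_sub_div hD.ne']
    gcongr
    linarith
  · field_simp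
    ring

/-- The upper bound given by weak duality. -/
lemma rankProb_zero_le (hn : 3 ≤ n) {ℓ : ℕ} (hℓ : ℓ ∈ argminSet n) {f : AllocationRule n β}
    {π : Fin n → ℝ} (hf : IsRanking f π) (hS : alternatingSum π = 0) :
    rankProb π 0 ≤ 1 - objective n ℓ := by
  have ha := rankProb_antitone hf.mem_Icc hf.antitone
  have h := sum_dualSlack_mul (by omega) π (objective n ℓ)
  have h0 : 0 ≤ ∑ k ∈ Finset.range n,
      dualSlack n (objective n ℓ) k * (rankProb π k - rankProb π (k + 1)) :=
    Finset.sum_nonneg fun k hk => mul_nonneg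
      (dualSlack_nonneg_and hn hℓ (Finset.mem_range.mp hk)).1
      (sub_nonneg.mpr (ha (Nat.le_succ k)))
  have hc : cumProb π n ≤ 1 := (sum_eq_cumProb π).symm.trans_le hf.sum_le_one
  have hδ := objective_mul_le_one hn hℓ
  have hδ0 := objective_nonneg n (show 1 ≤ ℓ from one_le_two.trans hℓ.1.1)
  have hn' : (1 : ℝ) ≤ n := by exact_mod_cast (by omega : 1 ≤ n)
  have hδ1 : objective n ℓ ≤ 1 := (le_mul_of_one_le_right hδ0 hn').trans hδ
  rw [hS] at h
  nlinarith [mul_le_of_le_one_right (sub_nonneg.mpr hδ1) hc]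

/-- Complementary slackness: if the minimizer is unique and the bound is attained, then only two
of the differences of consecutive probabilities are nonzero, and these are determined by the
total probability and the value of the bound. -/
lemma eq_optimalProb_of_rankProb_zero_eq (hn : 3 ≤ n) (h8 : n ≠ 8) {ℓ : ℕ}
    (hℓ : ℓ ∈ argminSet n) {f : AllocationRule n β} {π : Fin n → ℝ} (hf : IsRanking f π)
    (hS : alternatingSum π = 0) (h0 : rankProb π 0 = 1 - objective n ℓ) :
    π = optimalProb n ℓ := by
  have ha := rankProb_antitone hf.mem_Icc hf.antitone
  have h := sum_dualSlack_mul (by omega) π (objective n ℓ)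
  have hnn : ∀ k ∈ Finset.range n,
      0 ≤ dualSlack n (objective n ℓ) k * (rankProb π k - rankProb π (k + 1)) := fun k hk =>
    mul_nonneg (dualSlack_nonneg_and hn hℓ (Finset.mem_range.mp hk)).1
      (sub_nonneg.mpr (ha (Nat.le_succ k)))
  have hc : cumProb π n ≤ 1 := (sum_eq_cumProb π).symm.trans_le hf.sum_le_one
  have hδ := objective_mul_le_one hn hℓ
  have hδ0 := objective_nonneg n (show 1 ≤ ℓ from one_le_two.trans hℓ.1.1)
  have hn' : (3 : ℝ) ≤ n := by exact_mod_cast hn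
  have hδ1 : objective n ℓ < 1 := by nlinarith
  rw [hS, h0] at h
  have hsum := Finset.sum_nonneg hnn
  have hprod : 0 ≤ (1 - objective n ℓ) * (1 - cumProb π n) :=
    mul_nonneg (sub_nonneg.mpr hδ1.le) (sub_nonneg.mpr hc)
  have hzero : ∀ k ∈ Finset.range n,
      dualSlack n (objective n ℓ) k * (rankProb π k - rankProb π (k + 1)) = 0 :=
    (Finset.sum_eq_zero_iff_of_nonneg hnn).mp (by linarith)
  have hc1 : cumProb π n = 1 := by
    have : (1 - objective n ℓ) * (1 - cumProb π n) = 0 := by linarith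
    have := (mul_eq_zero.mp this).resolve_left (by linarith)
    linarith
  have hstep : ∀ k, 1 ≤ k → k ≠ ℓ - 1 → rankProb π k = rankProb π (k + 1) := by
    intro k hk hne
    by_cases hkn : k < n
    · rcases mul_eq_zero.mp (hzero k (Finset.mem_range.mpr hkn)) with hw | hx
      · rcases (dualSlack_nonneg_and hn hℓ hkn).2 hw with h | h
        · omega
        · have := argminSet_subsingleton hn h8 h hℓ
          omega
      · linarith
    · rw [rankProb_of_le π (not_lt.mp hkn), rankProb_of_le π (by omega)]
  obtain ⟨⟨h2, hln, -⟩, -⟩ := hℓ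
  have hhigh : ∀ k, ℓ ≤ k → rankProb π k = 0 := by
    have : ∀ t, rankProb π ℓ = rankProb π (ℓ + t) := by
      intro t
      induction t with
      | zero => rfl
      | succ t ih => rw [ih, hstep (ℓ + t) (by omega) (by omega)]; rfl
    intro k hk
    have h1 := this n
    have h2 := this (k - ℓ)
    rw [rankProb_of_le π (show n ≤ ℓ + n by omega)] at h1
    rw [Nat.add_sub_cancel' hk] at h2
    rw [← h2, h1]
  have hmid : ∀ k, 1 ≤ k → k < ℓ → rankProb π k = rankProb π 1 := by
    intro k hk
    induction k, hk using Nat.le_induction with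
    | base => exact fun _ => rfl
    | succ k hk ih =>
      intro hlt
      rw [← hstep k hk (by omega), ih (by omega)]
  have hform : ∀ k, rankProb π k = (if k < 1 then rankProb π 0 - rankProb π 1 else 0)
      + (if k < ℓ then rankProb π 1 else 0) := by
    intro k
    rcases Nat.eq_zero_or_pos k with rfl | hpos
    · simp [show 0 < ℓ by omega]
    · by_cases hk : k < ℓ
      · simp [hk, hmid k hpos hk, show ¬ k < 1 by omega]
      · simp [hk, hhigh k (not_lt.mp hk), show ¬ k < 1 by omega]
  have htot : rankProb π 0 - rankProb π 1 + ℓ * rankProb π 1 = 1 := by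
    rw [← hc1, cumProb]
    have e1 := sum_range_ite_lt (fun _ => 1) (rankProb π 0 - rankProb π 1)
      (show 1 ≤ n by omega)
    have e2 := sum_range_ite_lt (fun _ => 1) (rankProb π 1) (show ℓ ≤ n by omega)
    simp only [one_mul, Finset.sum_const, Finset.card_range, nsmul_eq_mul] at e1 e2
    rw [Finset.sum_congr rfl fun k _ => hform k, Finset.sum_add_distrib, e1, e2]
    push_cast
    ring
  have hD : ((n - 2).choose (ℓ - 1) : ℝ) + (ℓ : ℝ) ≠ 0 := by positivity
  have hone : rankProb π 1 = 1 / (((n - 2).choose (ℓ - 1) : ℝ) + (ℓ : ℝ)) := by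
    have hℓ1 : (ℓ : ℝ) - 1 ≠ 0 := by
      have : (2 : ℝ) ≤ ℓ := by exact_mod_cast h2
      linarith
    have : ((ℓ : ℝ) - 1) * rankProb π 1 = objective n ℓ := by
      rw [h0] at htot
      linarith
    refine mul_left_cancel₀ hℓ1 ?_
    rw [this, objective]
    ring
  funext i
  rw [← rankProb_val π i, optimalProb]
  split_ifs with hi hiℓ
  · rw [hi, h0, objective]
  · rw [hmid i (by omega) hiℓ, hone]
  · exact hhigh i (not_lt.mp hiℓ)

end RankingMechanism

open RankingMechanism in
theorem mainTheorem1 (n : ℕ) (hn : 3 ≤ n) (β : ℝ) (hβ : 0 < β) :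
    (RankingMechanism.argminSet n).Nonempty ∧
    ∀ ℓ ∈ RankingMechanism.argminSet n,
      ∃ f : RankingMechanism.AllocationRule n β,
        RankingMechanism.IsTwoStepRanking f (RankingMechanism.optimalProb n ℓ) ℓ ∧
        RankingMechanism.IsROptimal f (RankingMechanism.optimalProb n ℓ) ∧
        (n ≠ 8 →
          ∀ (g : RankingMechanism.AllocationRule n β) (ρ : Fin n → ℝ),
            RankingMechanism.IsROptimal g ρ →
              g = f ∧ ρ = RankingMechanism.optimalProb n ℓ) := by
  refine ⟨argminSet_nonempty hn, fun ℓ hℓ => ?_⟩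
  have hc := hℓ.1
  obtain ⟨f, hf⟩ := exists_isRanking (β := β) (optimalProb_mem_Icc hc) (optimalProb_antitone hc)
    ((sum_eq_cumProb _).trans (cumProb_optimalProb hc)).le
  have himp : IsSatisfactorilyImplementable f :=
    ⟨_, isSatisfactory_rankingPayment (by omega) hf (alternatingSum_optimalProb hc)⟩
  have hzero : ∀ ρ : Fin n → ℝ, rankProb ρ 0 = ρ ⟨0, by omega⟩ := fun ρ =>
    rankProb_val ρ ⟨0, by omega⟩
  have hopt : optimalProb n ℓ ⟨0, by omega⟩ = 1 - objective n ℓ := if_pos rfl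
  have hbound : ∀ (g : AllocationRule n β) (ρ : Fin n → ℝ), IsRanking g ρ →
      IsSatisfactorilyImplementable g → ρ ⟨0, by omega⟩ ≤ 1 - objective n ℓ :=
    fun g ρ hg hgi => hzero ρ ▸
      rankProb_zero_le hn hℓ hg (alternatingSum_eq_zero_of_implementable (by omega) hβ hg hgi)
  refine ⟨f, isTwoStepRanking_optimalProb hc hf, ⟨hf, himp, fun g ρ hg hgi i hi => ?_⟩,
    fun h8 g ρ ⟨hg, hgi, hmax⟩ => ?_⟩
  · rw [show i = ⟨0, by omega⟩ from Fin.ext hi]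
    exact hopt ▸ hbound g ρ hg hgi
  · have h0 : rankProb ρ 0 = 1 - objective n ℓ := by
      rw [hzero]
      exact le_antisymm (hbound g ρ hg hgi) (hopt ▸ hmax f _ hf himp _ rfl)
    have hρ := eq_optimalProb_of_rankProb_zero_eq hn h8 hℓ hg
      (alternatingSum_eq_zero_of_implementable (by omega) hβ hg hgi) h0
    exact ⟨(hρ ▸ hg).eq_of_same_prob hf, hρ⟩
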